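/- Let $S$ be a finite set, let $\Delta(S)=\{p\in\mathbb R^{S}: p_s\ge 0\ \text{for all } s,\ \sum_{s} p_s=1\}$, and let $|\cdot|$ and $\langle\cdot,\cdot\rangle$ be the Euclidean norm and inner product of $\mathbb R^S$. For $p\in\Delta(S)$ let $T_{\Delta(S)}(p)$ be the set of $z\in\mathbb R^S$ for which there is $\varepsilon>0$ with $p+\varepsilon z\in\Delta(S)$ and $p-\varepsilon z\in\Delta(S)$. For a symmetric matrix $X\in\mathbb R^{S\times S}$ let $$\lambda_{\max}(p,X)=\sup\Big\{\frac{\langle Xz,z\rangle}{|z|^2}\ :\ z\in T_{\Delta(S)}(p)\setminus\{0\}\Big\},$$ with $\lambda_{\max}(p,X)=-\infty$ if $T_{\Delta(S)}(p)=\{0\}$. Let $r>0$, let $H:\Delta(S)\times\mathbb R^S\to\mathbb R$ be a function, and consider the equation $$\min\big\{\,r\,w(p)+H(p,Dw(p))\ ;\ -\lambda_{\max}(p,D^2w(p))\,\big\}=0\quad\text{in }\Delta(S).\tag{E}$$ A function $w:\Delta(S)\to\mathbb R$ is a viscosity subsolution (respectively supersolution) of (E) if it is upper (respectively lower) semicontinuous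 and if, for every $C^\infty$ function $\phi:\mathbb R^{S}\to\mathbb R$ and every $p\in\Delta(S)$ (boundary points included) at which $w-\phi$ has a local maximum (respectively minimum) relative to $\Delta(S)$, $$\min\big\{\,r\,w(p)+H(p,D\phi(p))\ ;\ -\lambda_{\max}(p,D^2\phi(p))\,\big\}\le 0\qquad(\text{respectively }\ge 0).$$ A viscosity solution is a function that is both a subsolution and a supersolution. Theorem. Suppose that there is a constant $C$ such that $$|H(p,q)-H(p,q')|\le C|q-q'|\quad\text{and}\quad |H(p,q)-H(p',q)|\le C|p-p'|\,(|q|+1)$$ for all $p,p'\in\Delta(S)$ and $q,q'\in\mathbb R^S$. If $w_1$ is a continuous viscosity subsolution of (E) and $w_2$ is a continuous viscosity supersolution of (E), then $w_1\le w_2$ on $\Delta(S)$. In particular, (E) has at most one continuous viscosity solution. -/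

import Mathlib

open scoped ContDiff

noncomputable section

/-- The simplex `Δ(S)` of probability vectors, as a subset of the Euclidean space `ℝ^S`. -/
def probSimplex (S : Type*) [Fintype S] : Set (EuclideanSpace ℝ S) :=
  {p | (∀ s, 0 ≤ p s) ∧ ∑ s, p s = 1}

/-- The tangent space to `Δ(S)` at `p`: the directions `z` such that `p ± ε z` belong to `Δ(S)`
for some `ε > 0`. -/
def simplexTangent {S : Type*} [Fintype S] (p : probSimplex S) : Set (EuclideanSpace ℝ S) :=
  {z | ∃ ε : ℝ, 0 < ε ∧ (p : EuclideanSpace ℝ S) + ε • z ∈ probSimplex S ∧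
    (p : EuclideanSpace ℝ S) - ε • z ∈ probSimplex S}

/-- `λ_max(p, X)`, the supremum of `⟨X z, z⟩ / |z|²` over the nonzero tangent vectors `z` at `p`.
It takes values in the extended reals, where the supremum of the empty set is `-∞`. -/
def lambdaMax {S : Type*} [Fintype S] (p : probSimplex S)
    (X : EuclideanSpace ℝ S →L[ℝ] EuclideanSpace ℝ S) : EReal :=
  ⨆ z ∈ simplexTangent p \ {0}, ((inner ℝ (X z) z / ‖z‖ ^ 2 : ℝ) : EReal)

/-- The Hessian `D²φ(x)`, as a linear operator on `ℝ^S`: the derivative of the gradient. -/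
def hessianOp {S : Type*} [Fintype S] (φ : EuclideanSpace ℝ S → ℝ) (x : EuclideanSpace ℝ S) :
    EuclideanSpace ℝ S →L[ℝ] EuclideanSpace ℝ S :=
  fderiv ℝ (gradient φ) x

/-- The value at `p` of `min { r w + H(p, Dφ(p)) ; -λ_max(p, D²φ(p)) }`, with `a` in the place
of `w(p)`. -/
def obstacleOp {S : Type*} [Fintype S] (r : ℝ)
    (H : probSimplex S → EuclideanSpace ℝ S → ℝ) (a : ℝ) (φ : EuclideanSpace ℝ S → ℝ)
    (p : probSimplex S) : EReal :=
  min ((r * a + H p (gradient φ (p : EuclideanSpace ℝ S)) : ℝ) : EReal)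
    (-lambdaMax p (hessianOp φ (p : EuclideanSpace ℝ S)))

/-- Viscosity subsolutions of `min { r w + H(p, Dw) ; -λ_max(p, D²w) } = 0` on `Δ(S)`. The local
maximum is relative to `Δ(S)`, and boundary points are tested too. -/
def IsObstacleSubsolution {S : Type*} [Fintype S] (r : ℝ)
    (H : probSimplex S → EuclideanSpace ℝ S → ℝ) (w : probSimplex S → ℝ) : Prop :=
  UpperSemicontinuous w ∧
    ∀ φ : EuclideanSpace ℝ S → ℝ, ContDiff ℝ ∞ φ → ∀ p : probSimplex S,
      IsLocalMax (fun x : probSimplex S => w x - φ (x : EuclideanSpace ℝ S)) p →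
        obstacleOp r H (w p) φ p ≤ 0

/-- Viscosity supersolutions of the same equation. -/
def IsObstacleSupersolution {S : Type*} [Fintype S] (r : ℝ)
    (H : probSimplex S → EuclideanSpace ℝ S → ℝ) (w : probSimplex S → ℝ) : Prop :=
  LowerSemicontinuous w ∧
    ∀ φ : EuclideanSpace ℝ S → ℝ, ContDiff ℝ ∞ φ → ∀ p : probSimplex S,
      IsLocalMin (fun x : probSimplex S => w x - φ (x : EuclideanSpace ℝ S)) p →
        0 ≤ obstacleOp r H (w p) φ p

/-- Viscosity solutions: both a subsolution and a supersolution. -/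
def IsObstacleSolution {S : Type*} [Fintype S] (r : ℝ)
    (H : probSimplex S → EuclideanSpace ℝ S → ℝ) (w : probSimplex S → ℝ) : Prop :=
  IsObstacleSubsolution r H w ∧ IsObstacleSupersolution r H w

end

open Filter Topology

/-! The obstacle term makes a supersolution concave on the relative interior (`concave_of_pos`), and
this concavity replaces the usual lemma on second-order jets. Doubling variables, one maximizes `w₁
x - w₂ y + θ|x|² - |y - κ x|²/ε²`, where the homothety `κ` towards the barycenter forces the
maximizing `y`, called `q`, into the relative interior. There the penalty touches `w₂` from below
with gradient `ξ`; by concavity `ξ` is then a supergradient of `w₂` (`le_add_inner`). Moving `x`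
from the maximizer `p` and `y` from `q` by `(1 - ε)(x - p)` leaves the penalty unchanged. Hence `w₁`
is touched from above at `p` by an affine function minus `θ|x|²`, whose Hessian is negative
definite. The obstacle term is thus strictly positive, and both viscosity inequalities concern the
Hamiltonian (`hamiltonian_le_of_doubled_max`). The Lipschitz bounds on `H` conclude. -/

/-! ### Geometry of the simplex. -/

theorem isCompact_probSimplex {S : Type*} [Fintype S] : IsCompact (probSimplex S) := by
  have h : probSimplex S = (EuclideanSpace.equiv S ℝ).toHomeomorph ⁻¹' stdSimplex ℝ S := by
    ext x
    simp [probSimplex, stdSimplex]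
  rw [h, Homeomorph.isCompact_preimage]
  exact isCompact_stdSimplex ℝ S

instance {S : Type*} [Fintype S] : CompactSpace (probSimplex S) :=
  isCompact_iff_compactSpace.mp isCompact_probSimplex

theorem norm_le_one_of_mem_probSimplex {S : Type*} [Fintype S] {x : EuclideanSpace ℝ S}
    (hx : x ∈ probSimplex S) : ‖x‖ ≤ 1 := by
  rw [EuclideanSpace.norm_eq, Real.sqrt_le_iff, one_pow]
  refine ⟨zero_le_one, hx.2 ▸ ?_⟩
  refine Finset.sum_le_sum fun s _ => ?_
  have h1 : x s ≤ 1 := by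
    rw [← hx.2]
    exact Finset.single_le_sum (fun i _ => hx.1 i) (Finset.mem_univ s)
  rw [Real.norm_eq_abs, sq_abs]
  nlinarith [hx.1 s]

theorem convex_probSimplex {S : Type*} [Fintype S] : Convex ℝ (probSimplex S) := by
  intro x hx y hy a b ha hb hab
  refine ⟨fun s => ?_, ?_⟩
  · simp only [PiLp.add_apply, PiLp.smul_apply, smul_eq_mul]
    exact add_nonneg (mul_nonneg ha (hx.1 s)) (mul_nonneg hb (hy.1 s))
  · simp only [PiLp.add_apply, PiLp.smul_apply, smul_eq_mul, Finset.sum_add_distrib,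
      ← Finset.mul_sum, hx.2, hy.2, mul_one, hab]

/-- At a point with full support, every direction of sum zero is tangent to the simplex. -/
theorem mem_simplexTangent_of_pos {S : Type*} [Fintype S] {p : probSimplex S}
    (hp : ∀ s, 0 < (p : EuclideanSpace ℝ S) s) {z : EuclideanSpace ℝ S} (hz : ∑ s, z s = 0) :
    z ∈ simplexTangent p := by
  have h : ∀ s, ∀ᶠ ε : ℝ in 𝓝 0, 0 < (p : EuclideanSpace ℝ S) s + ε * z s ∧
      0 < (p : EuclideanSpace ℝ S) s - ε * z s := by
    intro s
    refine Filter.Eventually.and ?_ ?_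
    · have hc : Continuous fun ε : ℝ => (p : EuclideanSpace ℝ S) s + ε * z s := by fun_prop
      exact hc.continuousAt.eventually_const_lt (by simpa using hp s)
    · have hc : Continuous fun ε : ℝ => (p : EuclideanSpace ℝ S) s - ε * z s := by fun_prop
      exact hc.continuousAt.eventually_const_lt (by simpa using hp s)
  obtain ⟨ε, hε, h0⟩ := (((eventually_all.2 h).filter_mono nhdsWithin_le_nhds).and
    (self_mem_nhdsWithin (s := Set.Ioi (0 : ℝ)))).exists
  refine ⟨ε, h0, ⟨fun s => ?_, ?_⟩, ⟨fun s => ?_, ?_⟩⟩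
  · simpa using (hε s).1.le
  · simp [Finset.sum_add_distrib, ← Finset.mul_sum, hz, p.2.2]
  · simpa using (hε s).2.le
  · simp [Finset.sum_sub_distrib, ← Finset.mul_sum, hz, p.2.2]

/-! ### Quadratic test functions. -/

/-- The quadratic test functions `x ↦ ⟨v, x - a⟩ + α ⟨z, x - a⟩² + κ |x - a|²`. -/
noncomputable def quadTest {S : Type*} [Fintype S] (v z a : EuclideanSpace ℝ S) (α κ : ℝ)
    (x : EuclideanSpace ℝ S) : ℝ :=
  inner ℝ v (x - a) + α * inner ℝ z (x - a) ^ 2 + κ * ‖x - a‖ ^ 2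

theorem contDiff_quadTest {S : Type*} [Fintype S] (v z a : EuclideanSpace ℝ S) (α κ : ℝ) :
    ContDiff ℝ ∞ (quadTest v z a α κ) := by
  have h : ContDiff ℝ ∞ fun x : EuclideanSpace ℝ S => x - a := contDiff_id.sub contDiff_const
  exact ((contDiff_const.inner ℝ h).add (contDiff_const.mul ((contDiff_const.inner ℝ h).pow 2))).add
    (contDiff_const.mul (h.norm_sq ℝ))

theorem gradient_quadTest {S : Type*} [Fintype S] (v z a : EuclideanSpace ℝ S) (α κ : ℝ)
    (x : EuclideanSpace ℝ S) :
    gradient (quadTest v z a α κ) x =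
      v + (2 * α * inner ℝ z (x - a)) • z + (2 * κ) • (x - a) := by
  apply HasGradientAt.gradient
  rw [hasGradientAt_iff_hasFDerivAt]
  have h : HasFDerivAt (fun x : EuclideanSpace ℝ S => x - a)
      (ContinuousLinearMap.id ℝ (EuclideanSpace ℝ S)) x := (hasFDerivAt_id x).sub_const a
  have hi : ∀ u : EuclideanSpace ℝ S, HasFDerivAt (fun x => inner ℝ u (x - a))
      (innerSL ℝ u) x := fun u => by
    exact (innerSL ℝ u).hasFDerivAt.comp x h
  have hq := ((hi v).add (((hi z).pow 2).const_mul α)).add (h.norm_sq.const_mul κ)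
  refine hq.congr_fderiv ?_
  ext y
  simp
  ring

theorem hessianOp_quadTest_apply {S : Type*} [Fintype S] (v z a : EuclideanSpace ℝ S) (α κ : ℝ)
    (x y : EuclideanSpace ℝ S) :
    hessianOp (quadTest v z a α κ) x y = (2 * α * inner ℝ z y) • z + (2 * κ) • y := by
  have hg : gradient (quadTest v z a α κ) = fun x =>
      v + (2 * α * inner ℝ z (x - a)) • z + (2 * κ) • (x - a) :=
    funext fun x => gradient_quadTest v z a α κ x
  have h : HasFDerivAt (fun x : EuclideanSpace ℝ S => x - a)
      (ContinuousLinearMap.id ℝ (EuclideanSpace ℝ S)) x := (hasFDerivAt_id x).sub_const a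
  have hi : HasFDerivAt (fun x => inner ℝ z (x - a)) (innerSL ℝ z) x := by
    exact (innerSL ℝ z).hasFDerivAt.comp x h
  have hq : HasFDerivAt (fun x => v + (2 * α * inner ℝ z (x - a)) • z + (2 * κ) • (x - a)) _ x :=
    (((hi.const_mul (2 * α)).smul_const z).const_add v).add (h.const_smul (2 * κ))
  rw [hessianOp, hg, hq.fderiv]
  simp

/-! ### The viscosity inequalities over the reals. -/

theorem IsObstacleSupersolution.hamiltonian_nonneg {S : Type*} [Fintype S] {r : ℝ}
    {H : probSimplex S → EuclideanSpace ℝ S → ℝ} {w : probSimplex S → ℝ}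
    (hw : IsObstacleSupersolution r H w) {φ : EuclideanSpace ℝ S → ℝ} (hφ : ContDiff ℝ ∞ φ)
    {p : probSimplex S} (hp : IsLocalMin (fun x : probSimplex S => w x - φ x) p) :
    0 ≤ r * w p + H p (gradient φ p) := by
  exact_mod_cast (le_min_iff.1 (hw.2 φ hφ p hp)).1

theorem IsObstacleSupersolution.hessian_nonpos {S : Type*} [Fintype S] {r : ℝ}
    {H : probSimplex S → EuclideanSpace ℝ S → ℝ} {w : probSimplex S → ℝ}
    (hw : IsObstacleSupersolution r H w) {φ : EuclideanSpace ℝ S → ℝ} (hφ : ContDiff ℝ ∞ φ)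
    {p : probSimplex S} (hp : IsLocalMin (fun x : probSimplex S => w x - φ x) p)
    {z : EuclideanSpace ℝ S} (hz : z ∈ simplexTangent p) :
    inner ℝ (hessianOp φ p z) z ≤ 0 := by
  rcases eq_or_ne z 0 with rfl | h0
  · simp
  have h1 : lambdaMax p (hessianOp φ p) ≤ 0 := by
    have := EReal.neg_le_neg_iff.2 (le_min_iff.1 (hw.2 φ hφ p hp)).2
    simpa using this
  have h2 : ((inner ℝ (hessianOp φ p z) z / ‖z‖ ^ 2 : ℝ) : EReal) ≤ 0 :=
    (le_iSup₂_of_le (f := fun z (_ : z ∈ simplexTangent p \ {0}) =>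
      ((inner ℝ (hessianOp φ p z) z / ‖z‖ ^ 2 : ℝ) : EReal)) z ⟨hz, h0⟩ le_rfl).trans h1
  have h3 : inner ℝ (hessianOp φ p z) z / ‖z‖ ^ 2 ≤ 0 := by exact_mod_cast h2
  have h4 : 0 < ‖z‖ ^ 2 := by positivity
  simpa using (div_le_iff₀ h4).1 h3

/-- A uniformly negative Hessian gives `-λ_max ≥ c > 0`, also when `λ_max = -∞`, so only the first
term of the minimum can be nonpositive. -/
theorem IsObstacleSubsolution.hamiltonian_nonpos {S : Type*} [Fintype S] {r : ℝ}
    {H : probSimplex S → EuclideanSpace ℝ S → ℝ} {w : probSimplex S → ℝ}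
    (hw : IsObstacleSubsolution r H w) {φ : EuclideanSpace ℝ S → ℝ} (hφ : ContDiff ℝ ∞ φ)
    {p : probSimplex S} (hp : IsLocalMax (fun x : probSimplex S => w x - φ x) p)
    {c : ℝ} (hc : 0 < c) (hX : ∀ z, inner ℝ (hessianOp φ p z) z ≤ -c * ‖z‖ ^ 2) :
    r * w p + H p (gradient φ p) ≤ 0 := by
  have h1 : lambdaMax p (hessianOp φ p) ≤ ((-c : ℝ) : EReal) := by
    refine iSup₂_le fun z hz => ?_
    have h0 : z ≠ 0 := hz.2
    have h4 : 0 < ‖z‖ ^ 2 := by positivity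
    exact_mod_cast (div_le_iff₀ h4).2 (hX z)
  have h2 : (0 : EReal) < -lambdaMax p (hessianOp φ p) := by
    have := EReal.neg_le_neg_iff.2 h1
    refine lt_of_lt_of_le ?_ this
    rw [← EReal.coe_neg, neg_neg]
    exact_mod_cast hc
  rcases min_le_iff.1 (hw.2 φ hφ p hp) with h | h
  · exact_mod_cast h
  · exact absurd h (not_le.2 h2)

/-! ### Concavity of supersolutions in the relative interior. -/

set_option maxHeartbeats 400000 in
/-- A viscosity supersolution is concave along the segments whose endpoints have full support. -/
theorem IsObstacleSupersolution.concave_of_pos {S : Type*} [Fintype S] {r : ℝ}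
    {H : probSimplex S → EuclideanSpace ℝ S → ℝ} {w : probSimplex S → ℝ} (hwc : Continuous w)
    (hw : IsObstacleSupersolution r H w) {a c q : probSimplex S}
    (ha : ∀ s, 0 < (a : EuclideanSpace ℝ S) s) (hc : ∀ s, 0 < (c : EuclideanSpace ℝ S) s)
    {τ : ℝ} (hτ0 : 0 ≤ τ) (hτ1 : τ ≤ 1)
    (hq : (q : EuclideanSpace ℝ S) = a + τ • ((c : EuclideanSpace ℝ S) - a)) :
    w a + τ * (w c - w a) ≤ w q := by
  by_contra! hlt
  set z : EuclideanSpace ℝ S := (c : EuclideanSpace ℝ S) - a with hz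
  have hz0 : z ≠ 0 := by
    intro h0
    have h1 : c = a := Subtype.ext (sub_eq_zero.1 h0)
    have h2 : q = a := Subtype.ext (by simpa [h0] using hq)
    simp [h1, h2] at hlt
  set L : ℝ := ‖z‖ ^ 2 with hL
  have hLpos : 0 < L := by positivity
  have hzz : inner ℝ z z = L := real_inner_self_eq_norm_sq z
  obtain ⟨m, hm, hmq⟩ : ∃ m : ℝ, 0 < m ∧ w q = w a + τ * (w c - w a) - 2 * m :=
    ⟨(w a + τ * (w c - w a) - w q) / 2, by linarith, by ring⟩
  obtain ⟨B, hB⟩ : ∃ B, ∀ x, |w x| ≤ B := by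
    obtain ⟨B, hB⟩ := isCompact_univ.exists_bound_of_continuousOn hwc.continuousOn
    exact ⟨B, fun x => hB x trivial⟩
  have hB0 : 0 ≤ B := (abs_nonneg _).trans (hB a)
  obtain ⟨ρ, hρ, hρa, hρc, hwa, hwc'⟩ : ∃ ρ : ℝ, 0 < ρ ∧
      (∀ s, ρ < (a : EuclideanSpace ℝ S) s) ∧ (∀ s, ρ < (c : EuclideanSpace ℝ S) s) ∧
      (∀ x : probSimplex S, ‖(x : EuclideanSpace ℝ S) - a‖ < ρ → w a - m < w x) ∧
      (∀ x : probSimplex S, ‖(x : EuclideanSpace ℝ S) - c‖ < ρ → w c - m < w x) := by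
    have hnear : ∀ y : probSimplex S, ∀ᶠ ρ : ℝ in 𝓝[>] 0,
        ∀ x : probSimplex S, ‖(x : EuclideanSpace ℝ S) - y‖ < ρ → w y - m < w x := by
      intro y
      obtain ⟨ε, hε, h⟩ := Metric.eventually_nhds_iff.1
        (hwc.continuousAt.eventually_const_lt (show w y - m < w y by linarith))
      filter_upwards [Ioo_mem_nhdsGT hε] with ρ hρ x hx
      refine h ?_
      rw [Subtype.dist_eq, dist_eq_norm]
      exact hx.trans hρ.2
    have hpos : ∀ y : probSimplex S, (∀ s, 0 < (y : EuclideanSpace ℝ S) s) →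
        ∀ᶠ ρ : ℝ in 𝓝[>] 0, ∀ s, ρ < (y : EuclideanSpace ℝ S) s := by
      intro y hy
      rw [eventually_all]
      intro s
      filter_upwards [Ioo_mem_nhdsGT (hy s)] with ρ hρ using hρ.2
    obtain ⟨ρ, ⟨⟨⟨h1, h2⟩, h3⟩, h4⟩, h5⟩ := (((((hpos a ha).and (hpos c hc)).and (hnear a)).and
      (hnear c)).and self_mem_nhdsWithin).exists
    exact ⟨ρ, h5, h1, h2, h3, h4⟩
  -- Since `|w| ≤ B`, this weight keeps the minimizer within `ρ` of the line through `a` and `c`.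
  set N : ℝ := (4 * B + 1) / ρ ^ 2 with hN
  have hNpos : 0 < N := by positivity
  have hNρ : N * ρ ^ 2 = 4 * B + 1 := by rw [hN]; field_simp
  set σ : probSimplex S → ℝ := fun x => inner ℝ z ((x : EuclideanSpace ℝ S) - a) / L with hσ
  have hσL : ∀ x : probSimplex S, inner ℝ z ((x : EuclideanSpace ℝ S) - a) = σ x * L := by
    intro x
    simp only [hσ]
    field_simp
  have hσc : Continuous σ := by
    have h : Continuous fun x : probSimplex S => (x : EuclideanSpace ℝ S) - a :=
      continuous_subtype_val.sub continuous_const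
    exact (continuous_const.inner h).div_const L
  have hdist : ∀ (x : probSimplex S) (t : ℝ), ‖(x : EuclideanSpace ℝ S) - a - t • z‖ ^ 2 =
      ‖(x : EuclideanSpace ℝ S) - a‖ ^ 2 - 2 * t * (σ x * L) + t ^ 2 * L := by
    intro x t
    rw [norm_sub_sq_real, real_inner_smul_right, real_inner_comm, hσL, norm_smul, mul_pow,
      Real.norm_eq_abs, sq_abs]
    ring
  -- Up to a constant, `φ` is the chord plus the convex bump `m σ (σ - 1)` minus `N d²`, with `d`
  -- the distance to the line; the coefficients come from `d² = |x - a|² - σ² L`.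
  set φ : EuclideanSpace ℝ S → ℝ :=
    quadTest (((w c - w a - m) / L) • z) z a ((m + N * L) / L ^ 2) (-N) with hφ
  have hφσ : ∀ x : probSimplex S, φ x = (w c - w a) * σ x + m * (σ x * (σ x - 1)) -
      N * ‖(x : EuclideanSpace ℝ S) - a - σ x • z‖ ^ 2 := by
    intro x
    rw [hdist]
    simp only [hφ, quadTest, real_inner_smul_left, hσL]
    field_simp
    ring
  have hφc : Continuous φ := (contDiff_quadTest _ _ _ _ _).continuous
  have hσq : σ q = τ := by
    simp only [hσ, hq, add_sub_cancel_left, real_inner_smul_right, hzz]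
    field_simp
  have hφq : φ q = (w c - w a) * τ + m * (τ * (τ - 1)) := by
    rw [hφσ, hσq, hq]
    simp
  obtain ⟨x, hxB, hxmin⟩ := ((isClosed_Icc (a := (0 : ℝ)) (b := 1)).preimage hσc).isCompact
    |>.exists_isMinOn ⟨q, by simpa [hσq] using ⟨hτ0, hτ1⟩⟩
      (hwc.sub (hφc.comp continuous_subtype_val)).continuousOn
  have hxq : w x - φ x ≤ w q - φ q := hxmin (by simpa [hσq] using ⟨hτ0, hτ1⟩)
  have hx0 : 0 ≤ σ x := hxB.1
  have hx1 : σ x ≤ 1 := hxB.2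
  set d : ℝ := ‖(x : EuclideanSpace ℝ S) - a - σ x • z‖ with hd
  have hval : w x - ((w c - w a) * σ x + m * (σ x * (σ x - 1)) - N * d ^ 2) ≤ w a - m := by
    rw [← hφσ]
    nlinarith [mul_nonneg hm.le (sq_nonneg τ), mul_nonneg hm.le (sub_nonneg.2 hτ1)]
  have hdρ : d < ρ := by
    have h1 := abs_le.1 (hB x)
    have h2 := abs_le.1 (hB a)
    have h3 := abs_le.1 (hB c)
    have h4 : N * d ^ 2 < N * ρ ^ 2 := by
      rw [hNρ]
      have h5 : (w c - w a) * σ x ≤ w c - w a ∨ (w c - w a) * σ x ≤ 0 := by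
        rcases le_total 0 (w c - w a) with h | h
        · exact Or.inl (mul_le_of_le_one_right h hx1)
        · exact Or.inr (mul_nonpos_of_nonpos_of_nonneg h hx0)
      have h6 : m * (σ x * (σ x - 1)) ≤ 0 :=
        mul_nonpos_of_nonneg_of_nonpos hm.le
          (mul_nonpos_of_nonneg_of_nonpos hx0 (sub_nonpos.2 hx1))
      rcases h5 with h5 | h5 <;> linarith
    exact lt_of_pow_lt_pow_left₀ 2 hρ.le (lt_of_mul_lt_mul_left h4 hNpos.le)
  have hNd : 0 ≤ N * d ^ 2 := by positivity
  -- On the end faces of the slab, within `ρ` of `a` or `c`, `w - φ` exceeds `w a - m`, while its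
  -- value at `q` is at most that. So the minimum is not on these faces.
  have hx0' : 0 < σ x := by
    refine lt_of_le_of_ne hx0 fun h => ?_
    have h1 : ‖(x : EuclideanSpace ℝ S) - a‖ < ρ := by simpa [hd, ← h] using hdρ
    have h2 := hwa x h1
    rw [← h] at hval
    linarith
  have hx1' : σ x < 1 := by
    refine lt_of_le_of_ne hx1 fun h => ?_
    have h1 : ‖(x : EuclideanSpace ℝ S) - c‖ < ρ := by
      have : (x : EuclideanSpace ℝ S) - c =
          (x : EuclideanSpace ℝ S) - (a : EuclideanSpace ℝ S) - σ x • z := by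
        rw [h, one_smul, hz, sub_sub_sub_cancel_right]
      rw [this]
      exact hdρ
    have h2 := hwc' x h1
    rw [h] at hval
    linarith
  -- `x` is within `ρ` of a point of the segment, whose coordinates all exceed `ρ`. Hence `z` is
  -- tangent at `x`, although `x` may lie off the segment.
  have hxpos : ∀ s, 0 < (x : EuclideanSpace ℝ S) s := by
    intro s
    have h1 : ‖((x : EuclideanSpace ℝ S) - (a : EuclideanSpace ℝ S) - σ x • z) s‖ < ρ :=
      (PiLp.norm_apply_le _ s).trans_lt hdρ
    rw [Real.norm_eq_abs, abs_lt] at h1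
    have h2 := h1.1
    simp only [hz, PiLp.sub_apply, PiLp.smul_apply, smul_eq_mul] at h2
    nlinarith [hρa s, hρc s, mul_pos hx0' (sub_pos.2 (hρc s)),
      mul_pos (sub_pos.2 hx1') (sub_pos.2 (hρa s))]
  have hloc : IsLocalMin (fun y : probSimplex S => w y - φ y) x := by
    have : σ ⁻¹' Set.Icc 0 1 ∈ 𝓝 x := hσc.continuousAt (Icc_mem_nhds hx0' hx1')
    exact hxmin.isLocalMin this
  have hzT : z ∈ simplexTangent x :=
    mem_simplexTangent_of_pos hxpos (by simp [hz, Finset.sum_sub_distrib, a.2.2, c.2.2])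
  have hneg := hw.hessian_nonpos (contDiff_quadTest _ _ _ _ _) hloc hzT
  rw [hessianOp_quadTest_apply, inner_add_left, real_inner_smul_left, real_inner_smul_left,
    hzz] at hneg
  have : 2 * ((m + N * L) / L ^ 2) * L * L + 2 * (-N) * L = 2 * m := by
    field_simp
    ring
  linarith

/-- If a supersolution is touched from below at a point of full support by a smooth function with
gradient `ξ`, then `ξ` is a supergradient there. -/
theorem IsObstacleSupersolution.le_add_inner {S : Type*} [Fintype S] {r : ℝ}
    {H : probSimplex S → EuclideanSpace ℝ S → ℝ} {w : probSimplex S → ℝ} (hwc : Continuous w)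
    (hw : IsObstacleSupersolution r H w) {q y : probSimplex S}
    (hq : ∀ s, 0 < (q : EuclideanSpace ℝ S) s) (hy : ∀ s, 0 < (y : EuclideanSpace ℝ S) s)
    {ξ : EuclideanSpace ℝ S} {k : ℝ}
    (hξ : ∀ x : probSimplex S, w q + inner ℝ ξ ((x : EuclideanSpace ℝ S) - q) -
      k * ‖(x : EuclideanSpace ℝ S) - q‖ ^ 2 ≤ w x) :
    w y ≤ w q + inner ℝ ξ ((y : EuclideanSpace ℝ S) - q) := by
  set h : EuclideanSpace ℝ S := (y : EuclideanSpace ℝ S) - q with hh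
  have hev : ∀ᶠ t : ℝ in 𝓝[>] 0, w y ≤ w q + inner ℝ ξ h + k * t * ‖h‖ ^ 2 := by
    have hpos : ∀ᶠ t : ℝ in 𝓝 0, ∀ s, 0 < (q : EuclideanSpace ℝ S) s - t * h s := by
      rw [eventually_all]
      intro s
      have hc : Continuous fun t : ℝ => (q : EuclideanSpace ℝ S) s - t * h s := by fun_prop
      exact hc.continuousAt.eventually_const_lt (by simpa using hq s)
    filter_upwards [hpos.filter_mono nhdsWithin_le_nhds, self_mem_nhdsWithin] with t ht ht0
    replace ht0 : 0 < t := ht0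
    -- Extend the segment from `y` slightly beyond `q`: concavity at `q` and the quadratic lower
    -- bound at `a` bound `w y` with an error `k t |h|²`, which vanishes as `t → 0`.
    let a : probSimplex S := ⟨(q : EuclideanSpace ℝ S) - t • h, fun s => by simpa using (ht s).le,
      by simp [hh, Finset.sum_sub_distrib, ← Finset.mul_sum, y.2.2, q.2.2]⟩
    have hconc := hw.concave_of_pos hwc (a := a) (c := y) (q := q) (τ := t / (1 + t))
      (fun s => by simpa [a] using ht s) hy (by positivity)
      ((div_le_one (by positivity)).2 (by linarith)) (by
        have : (y : EuclideanSpace ℝ S) - a = (1 + t) • h := by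
          simp only [a, hh]
          module
        rw [this, smul_smul, div_mul_cancel₀ _ (by positivity)]
        simp [a])
    have ha := hξ a
    have hd : (a : EuclideanSpace ℝ S) - q = -(t • h) := by simp [a]
    rw [hd, norm_neg, norm_smul, inner_neg_right, real_inner_smul_right, mul_pow,
      Real.norm_eq_abs, sq_abs] at ha
    have h1 : w a + t * w y ≤ (1 + t) * w q := by
      have h2 : w a + t / (1 + t) * (w y - w a) = (w a + t * w y) / (1 + t) := by
        field_simp
        ring
      rw [h2, div_le_iff₀ (by positivity)] at hconc
      linarith
    have h3 : t * w y ≤ t * (w q + inner ℝ ξ h + k * t * ‖h‖ ^ 2) := by nlinarith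
    exact le_of_mul_le_mul_left h3 ht0
  refine ge_of_tendsto (f := fun t : ℝ => w q + inner ℝ ξ h + k * t * ‖h‖ ^ 2) ?_ hev
  have hc : Continuous fun t : ℝ => w q + inner ℝ ξ h + k * t * ‖h‖ ^ 2 := by fun_prop
  simpa using (hc.tendsto 0).mono_left nhdsWithin_le_nhds

/-! ### Doubling of variables with a shift into the interior. -/

/-- The barycenter of the simplex. -/
noncomputable def simplexBarycenter (S : Type*) [Fintype S] [Nonempty S] : probSimplex S :=
  ⟨WithLp.toLp 2 fun _ => (Fintype.card S : ℝ)⁻¹, fun _ => by simp, by simp⟩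

/-- The image of `x` under the homothety of ratio `1 - ε` centred at the barycenter. -/
noncomputable def contractSimplex {S : Type*} [Fintype S] [Nonempty S] {ε : ℝ} (h0 : 0 ≤ ε)
    (h1 : ε ≤ 1) (x : probSimplex S) : probSimplex S :=
  ⟨(1 - ε) • (x : EuclideanSpace ℝ S) + ε • (simplexBarycenter S : EuclideanSpace ℝ S),
    convex_probSimplex x.2 (simplexBarycenter S).2 (sub_nonneg.2 h1) h0 (by ring)⟩

/-- The estimate at a maximum point of the doubled function: the viscosity inequalities hold with
matching gradients. -/
theorem hamiltonian_le_of_doubled_max {S : Type*} [Fintype S] [Nonempty S] {r : ℝ}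
    {H : probSimplex S → EuclideanSpace ℝ S → ℝ} {w₁ w₂ : probSimplex S → ℝ}
    (hw₁ : IsObstacleSubsolution r H w₁) (hc₂ : Continuous w₂)
    (hw₂ : IsObstacleSupersolution r H w₂) {ε δ : ℝ} (hε0 : 0 < ε) (hε1 : ε < 1) (hδ : 0 < δ)
    {p q : probSimplex S} (hq : ∀ s, 0 < (q : EuclideanSpace ℝ S) s)
    (hmax : ∀ x y : probSimplex S,
      w₁ x - w₂ y + δ * ‖(x : EuclideanSpace ℝ S)‖ ^ 2 -
        (ε ^ 2)⁻¹ * ‖(y : EuclideanSpace ℝ S) - contractSimplex hε0.le hε1.le x‖ ^ 2 ≤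
      w₁ p - w₂ q + δ * ‖(p : EuclideanSpace ℝ S)‖ ^ 2 -
        (ε ^ 2)⁻¹ * ‖(q : EuclideanSpace ℝ S) - contractSimplex hε0.le hε1.le p‖ ^ 2)
    {ξ : EuclideanSpace ℝ S}
    (hξ : ξ = -(2 * (ε ^ 2)⁻¹) • ((q : EuclideanSpace ℝ S) - contractSimplex hε0.le hε1.le p)) :
    r * (w₁ p - w₂ q) ≤ H q ξ - H p ((1 - ε) • ξ - (2 * δ) • (p : EuclideanSpace ℝ S)) := by
  set c : EuclideanSpace ℝ S := (contractSimplex hε0.le hε1.le p : EuclideanSpace ℝ S) with hcdef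
  set k : ℝ := (ε ^ 2)⁻¹ with hk
  have hsup : 0 ≤ r * w₂ q + H q ξ := by
    have h := hw₂.hamiltonian_nonneg (contDiff_quadTest 0 0 c 0 (-k)) (p := q) (by
      refine Filter.Eventually.of_forall fun y => ?_
      have := hmax p y
      simp only [quadTest, inner_zero_left]
      linarith)
    rw [gradient_quadTest] at h
    simpa [hξ] using h
  -- Expanding the penalty around `q` gives the quadratic lower bound with slope `ξ`.
  have hlow : ∀ x : probSimplex S, w₂ q + inner ℝ ξ ((x : EuclideanSpace ℝ S) - q) -
      k * ‖(x : EuclideanSpace ℝ S) - q‖ ^ 2 ≤ w₂ x := by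
    intro x
    have h1 := hmax p x
    have h2 : (x : EuclideanSpace ℝ S) - c =
      ((x : EuclideanSpace ℝ S) - q) + ((q : EuclideanSpace ℝ S) - c) := by abel
    rw [← hcdef, h2, norm_add_sq_real, real_inner_comm] at h1
    rw [hξ, real_inner_smul_left]
    linarith
  have hsub : r * w₁ p + H p ((1 - ε) • ξ - (2 * δ) • (p : EuclideanSpace ℝ S)) ≤ 0 := by
    have h := hw₁.hamiltonian_nonpos (contDiff_quadTest ((1 - ε) • ξ) 0 0 0 (-δ)) (p := p) (by
      have hpos : ∀ᶠ x : probSimplex S in 𝓝 p, ∀ s, 0 < (q : EuclideanSpace ℝ S) s +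
          (1 - ε) * ((x : EuclideanSpace ℝ S) s - (p : EuclideanSpace ℝ S) s) := by
        rw [eventually_all]
        intro s
        have hc : Continuous fun x : probSimplex S => (q : EuclideanSpace ℝ S) s +
          (1 - ε) * ((x : EuclideanSpace ℝ S) s - (p : EuclideanSpace ℝ S) s) := by fun_prop
        exact hc.continuousAt.eventually_const_lt (by simpa using hq s)
      filter_upwards [hpos] with x hx
      -- The factor `1 - ε` is the ratio of the homothety, so the penalty at `(x, y)` equals that at
      -- `(p, q)`.
      let y : probSimplex S := ⟨(q : EuclideanSpace ℝ S) +
        (1 - ε) • ((x : EuclideanSpace ℝ S) - p), fun s => by simpa using (hx s).le, by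
          simp [Finset.sum_add_distrib, ← Finset.mul_sum, Finset.sum_sub_distrib, x.2.2,
            q.2.2, p.2.2]⟩
      have h1 := hw₂.le_add_inner hc₂ hq (y := y) (fun s => by simpa [y] using hx s) hlow
      have h2 := hmax x y
      have h3 : (y : EuclideanSpace ℝ S) - contractSimplex hε0.le hε1.le x =
          (q : EuclideanSpace ℝ S) - c := by
        simp only [y, hcdef, contractSimplex]
        module
      have h4 : (y : EuclideanSpace ℝ S) - q = (1 - ε) • ((x : EuclideanSpace ℝ S) - p) := by
        simp [y]
      rw [h3] at h2
      rw [h4, real_inner_smul_right, inner_sub_right] at h1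
      simp only [quadTest, inner_zero_left, real_inner_smul_left, sub_zero]
      linarith) (c := 2 * δ) (by positivity) (fun z => by
        rw [hessianOp_quadTest_apply]
        simp [real_inner_smul_left])
    rw [gradient_quadTest] at h
    simpa [sub_eq_add_neg] using h
  linarith

/-! ### The comparison principle. -/

set_option maxHeartbeats 400000 in
/-- Comparison principle: a continuous subsolution lies below a continuous supersolution. -/
theorem IsObstacleSubsolution.le_supersolution {S : Type*} [Fintype S] {r : ℝ} (hr : 0 < r)
    {H : probSimplex S → EuclideanSpace ℝ S → ℝ} {C : ℝ}
    (hH1 : ∀ (p : probSimplex S) (q q' : EuclideanSpace ℝ S),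
      |H p q - H p q'| ≤ C * ‖q - q'‖)
    (hH2 : ∀ (p p' : probSimplex S) (q : EuclideanSpace ℝ S),
      |H p q - H p' q| ≤
        C * ‖(p : EuclideanSpace ℝ S) - (p' : EuclideanSpace ℝ S)‖ * (‖q‖ + 1))
    {w₁ w₂ : probSimplex S → ℝ} (hc₁ : Continuous w₁) (hw₁ : IsObstacleSubsolution r H w₁)
    (hc₂ : Continuous w₂) (hw₂ : IsObstacleSupersolution r H w₂) (p₀ : probSimplex S) :
    w₁ p₀ ≤ w₂ p₀ := by
  by_contra! hlt
  have hne : Nonempty S := by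
    by_contra h
    rw [not_nonempty_iff] at h
    simpa using p₀.2.2
  obtain ⟨m, hm, hmp⟩ : ∃ m : ℝ, 0 < m ∧ w₁ p₀ - w₂ p₀ = m := ⟨_, sub_pos.2 hlt, rfl⟩
  obtain ⟨K, hK, hCK⟩ : ∃ K : ℝ, 1 ≤ K ∧ C ≤ K := ⟨max 1 C, le_max_left _ _, le_max_right _ _⟩
  obtain ⟨B, hB⟩ : ∃ B, ∀ x, |w₂ x| ≤ B := by
    obtain ⟨B, hB⟩ := isCompact_univ.exists_bound_of_continuousOn hc₂.continuousOn
    exact ⟨B, fun x => hB x trivial⟩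
  have hB0 : 0 ≤ B := (abs_nonneg _).trans (hB p₀)
  set n : ℝ := (Fintype.card S : ℝ)⁻¹ with hn
  have hn0 : 0 < n := by
    have : 0 < Fintype.card S := Fintype.card_pos
    positivity
  -- `θ` bounds all the error terms at once.
  obtain ⟨θ, hθ0, hθ1, hθn, hθm, hθr⟩ : ∃ θ : ℝ, 0 < θ ∧ θ < 1 ∧ θ < n ∧ 4 * θ < m ∧
      26 * K * θ < r * m := by
    have h : ∀ᶠ θ : ℝ in 𝓝[>] 0, 0 < θ ∧ θ < 1 ∧ θ < n ∧ θ < m / 4 ∧ θ < r * m / (26 * K) := by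
      filter_upwards [self_mem_nhdsWithin, Ioo_mem_nhdsGT one_pos, Ioo_mem_nhdsGT hn0,
        Ioo_mem_nhdsGT (show 0 < m / 4 by positivity),
        Ioo_mem_nhdsGT (show 0 < r * m / (26 * K) by positivity)] with θ h1 h2 h3 h4 h5
      exact ⟨h1, h2.2, h3.2, h4.2, h5.2⟩
    obtain ⟨θ, h1, h2, h3, h4, h5⟩ := h.exists
    refine ⟨θ, h1, h2, h3, by linarith, ?_⟩
    rw [lt_div_iff₀ (by positivity)] at h5
    linarith
  obtain ⟨ρ, hρ, huc⟩ := Metric.uniformContinuous_iff.1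
    (CompactSpace.uniformContinuous_of_continuous hc₂) (θ ^ 2) (by positivity)
  have hmod : ∀ x y : probSimplex S, ‖(x : EuclideanSpace ℝ S) - y‖ < ρ →
      |w₂ x - w₂ y| < θ ^ 2 := by
    intro x y h
    have := huc (a := x) (b := y) (by rwa [Subtype.dist_eq, dist_eq_norm])
    rwa [Real.dist_eq] at this
  obtain ⟨ε, hε0, hεθ, hερ⟩ : ∃ ε : ℝ, 0 < ε ∧ ε < θ ∧ ε * (2 * B + 2) < ρ := by
    obtain ⟨ε, h1, h2⟩ := exists_between (lt_min hθ0 (show 0 < ρ / (2 * B + 2) by positivity))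
    exact ⟨ε, h1, h2.trans_le (min_le_left _ _),
      (lt_div_iff₀ (by positivity)).1 (h2.trans_le (min_le_right _ _))⟩
  have hε1 : ε < 1 := hεθ.trans hθ1
  set κ : probSimplex S → probSimplex S := contractSimplex hε0.le hε1.le with hκ
  have hκc : Continuous fun x : probSimplex S => (κ x : EuclideanSpace ℝ S) :=
    (continuous_subtype_val.const_smul (1 - ε)).add continuous_const
  have hκx : ∀ x : probSimplex S, (κ x : EuclideanSpace ℝ S) - x =
      ε • ((simplexBarycenter S : EuclideanSpace ℝ S) - x) := by
    intro x
    simp only [hκ, contractSimplex]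
    module
  have hκn : ∀ x : probSimplex S, ‖(κ x : EuclideanSpace ℝ S) - x‖ ≤ 2 * ε := by
    intro x
    rw [hκx, norm_smul, Real.norm_of_nonneg hε0.le, mul_comm]
    refine mul_le_mul_of_nonneg_right ?_ hε0.le
    have h1 := norm_le_one_of_mem_probSimplex (simplexBarycenter S).2
    have h2 := norm_le_one_of_mem_probSimplex x.2
    linarith [norm_sub_le (simplexBarycenter S : EuclideanSpace ℝ S) x]
  have hΦc : Continuous fun x : probSimplex S × probSimplex S =>
      w₁ x.1 - w₂ x.2 + θ * ‖(x.1 : EuclideanSpace ℝ S)‖ ^ 2 -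
        (ε ^ 2)⁻¹ * ‖(x.2 : EuclideanSpace ℝ S) - κ x.1‖ ^ 2 := by
    have h := hκc.comp (continuous_fst (X := probSimplex S) (Y := probSimplex S))
    simp only [Function.comp_def] at h
    fun_prop
  obtain ⟨⟨p, q⟩, -, hpq⟩ := isCompact_univ.exists_isMaxOn ⟨(p₀, p₀), trivial⟩ hΦc.continuousOn
  have hmax : ∀ x y : probSimplex S,
      w₁ x - w₂ y + θ * ‖(x : EuclideanSpace ℝ S)‖ ^ 2 -
        (ε ^ 2)⁻¹ * ‖(y : EuclideanSpace ℝ S) - κ x‖ ^ 2 ≤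
      w₁ p - w₂ q + θ * ‖(p : EuclideanSpace ℝ S)‖ ^ 2 -
        (ε ^ 2)⁻¹ * ‖(q : EuclideanSpace ℝ S) - κ p‖ ^ 2 :=
    fun x y => hpq (Set.mem_univ (x, y))
  -- The rescaled offset `u` is small.
  obtain ⟨u, hu⟩ : ∃ u : EuclideanSpace ℝ S, (q : EuclideanSpace ℝ S) - κ p = ε • u :=
    ⟨ε⁻¹ • ((q : EuclideanSpace ℝ S) - κ p), by rw [smul_inv_smul₀ hε0.ne']⟩
  have hun : (ε ^ 2)⁻¹ * ‖(q : EuclideanSpace ℝ S) - κ p‖ ^ 2 = ‖u‖ ^ 2 := by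
    rw [hu, norm_smul, mul_pow, Real.norm_eq_abs, sq_abs]
    field_simp
  have hu2 : ‖u‖ ^ 2 ≤ w₂ (κ p) - w₂ q := by
    have h := hmax p (κ p)
    rw [hun, sub_self, norm_zero] at h
    linarith
  -- This crude bound puts `κ p` within `ρ` of `q`; the modulus of continuity of `w₂` then improves
  -- it to `|u| < θ`.
  have huB : ‖u‖ < 2 * B + 2 := by
    have h1 := abs_le.1 (hB (κ p))
    have h2 := abs_le.1 (hB q)
    nlinarith [sq_nonneg (‖u‖ - 1)]
  have huθ : ‖u‖ < θ := by
    have h1 : ‖(κ p : EuclideanSpace ℝ S) - q‖ < ρ := by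
      rw [norm_sub_rev, hu, norm_smul, Real.norm_of_nonneg hε0.le]
      exact (mul_lt_mul_of_pos_left huB hε0).trans hερ
    have h2 := (abs_lt.1 (hmod _ _ h1)).2
    exact lt_of_pow_lt_pow_left₀ 2 hθ0.le (hu2.trans_lt h2)
  -- The coordinates of `q` are `(1 - ε) p_s + ε (n + u_s)`, and `|u_s| < θ < n`. The weight `ε⁻²`
  -- makes the offset small compared with the shift `ε`.
  have hq : ∀ s, 0 < (q : EuclideanSpace ℝ S) s := by
    intro s
    have h1 : (q : EuclideanSpace ℝ S) = κ p + ε • u := by rw [← hu]; abel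
    have h2 := (abs_lt.1 (((PiLp.norm_apply_le u s).trans_lt huθ).trans hθn)).1
    rw [h1]
    simp only [hκ, contractSimplex, simplexBarycenter, PiLp.add_apply, PiLp.smul_apply,
      smul_eq_mul, ← hn]
    nlinarith [mul_nonneg (sub_nonneg.2 hε1.le) (p.2.1 s), mul_pos hε0 (neg_lt_iff_pos_add.1 h2)]
  have hgap : m / 2 ≤ w₁ p - w₂ q := by
    have h1 := hmax p₀ (κ p₀)
    rw [hun, sub_self, norm_zero] at h1
    have h2 : ‖(κ p₀ : EuclideanSpace ℝ S) - p₀‖ < ρ := by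
      refine (hκn p₀).trans_lt (lt_of_le_of_lt ?_ hερ)
      nlinarith [mul_nonneg hε0.le hB0]
    have h3 := (abs_lt.1 (hmod _ _ h2)).2
    have h4 : ‖(p : EuclideanSpace ℝ S)‖ ^ 2 ≤ 1 :=
      pow_le_one₀ (norm_nonneg _) (norm_le_one_of_mem_probSimplex p.2)
    have h5 : θ ^ 2 ≤ θ := by nlinarith
    have h6 : 0 ≤ θ * ‖(p₀ : EuclideanSpace ℝ S)‖ ^ 2 := by positivity
    nlinarith [sq_nonneg ‖u‖, mul_le_mul_of_nonneg_left h4 hθ0.le]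
  obtain ⟨ξ, hξ⟩ : ∃ ξ : EuclideanSpace ℝ S,
    ξ = -(2 * (ε ^ 2)⁻¹) • ((q : EuclideanSpace ℝ S) - κ p) := ⟨_, rfl⟩
  have hest := hamiltonian_le_of_doubled_max hw₁ hc₂ hw₂ hε0 hε1 hθ0 hq hmax hξ
  have hξn : ε * ‖ξ‖ = 2 * ‖u‖ := by
    rw [hξ, hu, norm_smul, norm_smul, norm_neg (2 * (ε ^ 2)⁻¹), Real.norm_of_nonneg (by positivity),
      Real.norm_of_nonneg hε0.le]
    field_simp
  have hqp : ‖(q : EuclideanSpace ℝ S) - p‖ ≤ 3 * ε := by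
    have h1 : (q : EuclideanSpace ℝ S) - p =
      ε • u + ((κ p : EuclideanSpace ℝ S) - p) := by rw [← hu]; abel
    rw [h1]
    refine (norm_add_le _ _).trans ?_
    rw [norm_smul, Real.norm_of_nonneg hε0.le]
    linarith [hκn p, mul_le_mul_of_nonneg_left (huθ.trans hθ1).le hε0.le]
  -- `ξ` may be of order `θ/ε`, but it is multiplied by `|q - p| ≤ 3ε`, and `ε|ξ| = 2|u|`.
  have e1 : H q ξ - H p ξ ≤ K * (9 * θ) := by
    have h1 : C * ‖(q : EuclideanSpace ℝ S) - p‖ * (‖ξ‖ + 1) ≤ K * (3 * ε) * (‖ξ‖ + 1) := by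
      gcongr
    have h2 := (le_abs_self _).trans (hH2 q p ξ)
    have h3 : K * (3 * ε) * (‖ξ‖ + 1) = K * (6 * ‖u‖ + 3 * ε) := by
      linear_combination 3 * K * hξn
    have h4 : K * (6 * ‖u‖ + 3 * ε) ≤ K * (9 * θ) :=
      mul_le_mul_of_nonneg_left (by linarith) (by linarith)
    linarith
  have e2 : H p ξ - H p ((1 - ε) • ξ - (2 * θ) • (p : EuclideanSpace ℝ S)) ≤ K * (4 * θ) := by
    have h1 := (le_abs_self _).trans
      (hH1 p ξ ((1 - ε) • ξ - (2 * θ) • (p : EuclideanSpace ℝ S)))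
    have h2 : ξ - ((1 - ε) • ξ - (2 * θ) • (p : EuclideanSpace ℝ S)) =
      ε • ξ + (2 * θ) • (p : EuclideanSpace ℝ S) := by module
    rw [h2] at h1
    have h3 : ‖ε • ξ + (2 * θ) • (p : EuclideanSpace ℝ S)‖ ≤ 4 * θ := by
      refine (norm_add_le _ _).trans ?_
      rw [norm_smul, norm_smul, Real.norm_of_nonneg hε0.le, Real.norm_of_nonneg (by positivity),
        hξn]
      linarith [mul_le_mul_of_nonneg_left (norm_le_one_of_mem_probSimplex p.2)
        (show 0 ≤ 2 * θ by positivity)]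
    refine h1.trans ?_
    gcongr
  -- The errors sum to `13 K θ`, against a left side of at least `r m / 2`; this is the source of
  -- the constant `26`.
  linarith [mul_le_mul_of_nonneg_left hgap hr.le]

theorem theorem3 {S : Type*} [Fintype S] (r : ℝ) (hr : 0 < r)
    (H : probSimplex S → EuclideanSpace ℝ S → ℝ) (C : ℝ)
    (hH1 : ∀ (p : probSimplex S) (q q' : EuclideanSpace ℝ S),
      |H p q - H p q'| ≤ C * ‖q - q'‖)
    (hH2 : ∀ (p p' : probSimplex S) (q : EuclideanSpace ℝ S),
      |H p q - H p' q| ≤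
        C * ‖(p : EuclideanSpace ℝ S) - (p' : EuclideanSpace ℝ S)‖ * (‖q‖ + 1)) :
    (∀ w₁ w₂ : probSimplex S → ℝ,
      Continuous w₁ → IsObstacleSubsolution r H w₁ →
      Continuous w₂ → IsObstacleSupersolution r H w₂ →
        ∀ p : probSimplex S, w₁ p ≤ w₂ p) ∧
    (∀ w w' : probSimplex S → ℝ,
      Continuous w → IsObstacleSolution r H w →
      Continuous w' → IsObstacleSolution r H w' → w = w') := by
  refine ⟨fun w₁ w₂ hc₁ hw₁ hc₂ hw₂ => hw₁.le_supersolution hr hH1 hH2 hc₁ hc₂ hw₂,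
    fun w w' hc hw hc' hw' => funext fun p => le_antisymm ?_ ?_⟩
  · exact hw.1.le_supersolution hr hH1 hH2 hc hc' hw'.2 p
  · exact hw'.1.le_supersolution hr hH1 hH2 hc' hc hw.2 p
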